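/- Let $\rho$ be a density matrix on $\mathbb C^2\otimes\mathbb C^2$ (a state of two qubits). Its fidelity is $F(\rho)=\max_\psi\langle\psi|\rho|\psi\rangle$, the maximum being over the maximally entangled vectors $\psi\in\mathbb C^2\otimes\mathbb C^2$ (unit vectors whose reduced states are $I/2$), and $$F^*(\rho)=\sup_\Lambda F(\Lambda(\rho)),$$ where $\Lambda$ runs over all trace-preserving LOCC operations (local operations and classical communication, with finitely many rounds) from two qubits to two qubits. Let $N(\rho)=\|\rho^\Gamma\|_1-1$ be the negativity, that is, twice the sum of the absolute values of the negative eigenvalues of the partial transpose $\rho^\Gamma$. Let $C(\rho)=\max(0,\lambda_1-\lambda_2-\lambda_3-\lambda_4)$ be the concurrence, where $\lambda_1\ge\lambda_2\ge\lambda_3\ge\lambda_4\ge 0$ are the square roots of the eigenvalues of $\rho\,(\sigma_y\otimes\sigma_y)\rho^*(\sigma_y\otimes\sigma_y)$, with $\rho^*$ the entrywise complex conjugate of $\rho$ and $\sigma_y=\begin{pmatrix}0&-i\\ i&0\end{pmatrix}$. Then $N(\rho)\le C(\rho)$ and $$\frac12\left(1+\frac{N(\rho)}{1+\sqrt{1-\left(N(\rho)/C(\rho)\right)^2}}\right)\;\le\;F^*(\rho)\;\le\;\frac12\bigl(1+N(\rho)\bigr),$$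 where $N(\rho)/C(\rho)$ is read as $0$ if $C(\rho)=0$ (then also $N(\rho)=0$). -/

import Mathlib

open scoped Kronecker ComplexOrder

noncomputable section

namespace TwoQubit

/-- Operators on `ℂ^a ⊗ ℂ^b`, written in the product basis. The first factor belongs to Alice, the
second one to Bob. -/
abbrev Op (a b : ℕ) : Type := Matrix (Fin a × Fin b) (Fin a × Fin b) ℂ

/-- Density operators on `ℂ^a ⊗ ℂ^b`. -/
structure IsState {a b : ℕ} (ρ : Op a b) : Prop where
  posSemidef : ρ.PosSemidef
  trace_eq_one : ρ.trace = 1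

/-- The partial transpose `ρ^Γ` with respect to Bob's system. -/
def partialTranspose {a b : ℕ} (ρ : Op a b) : Op a b :=
  Matrix.of fun x y => ρ (x.1, y.2) (y.1, x.2)

/-- The eigenvalues of a complex square matrix, with algebraic multiplicities. -/
def eigenvalueMultiset {ι : Type} [Fintype ι] [DecidableEq ι] (M : Matrix ι ι ℂ) : Multiset ℂ :=
  M.charpoly.roots

/-- The negativity, normalized to be `1` on Bell states: twice the sum of the absolute values of
the negative eigenvalues of `ρ^Γ` (which is Hermitian, with real eigenvalues, for a state `ρ`), that
is `‖ρ^Γ‖₁ - 1`. -/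
def negativity (ρ : Op 2 2) : ℝ :=
  2 * ((eigenvalueMultiset (partialTranspose ρ)).map fun z => max 0 (-z.re)).sum

/-- The Pauli matrix `σ_y`. -/
def sigmaY : Matrix (Fin 2) (Fin 2) ℂ := !![0, -Complex.I; Complex.I, 0]

/-- The spin-flipped operator `(σ_y ⊗ σ_y) ρ* (σ_y ⊗ σ_y)`; `ρ*` is the entrywise conjugate. -/
def spinFlip (ρ : Op 2 2) : Op 2 2 :=
  (sigmaY ⊗ₖ sigmaY) * ρ.map star * (sigmaY ⊗ₖ sigmaY)

/-- The square roots of the eigenvalues of `ρ ρ̃`, `ρ̃` the spin-flipped operator, with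
multiplicities. For a state `ρ` these eigenvalues are real and nonnegative. -/
def woottersNumbers (ρ : Op 2 2) : Multiset ℝ :=
  (eigenvalueMultiset (ρ * spinFlip ρ)).map fun z => Real.sqrt z.re

/-- The concurrence of Wootters, `max (0, l₁ - l₂ - l₃ - l₄)` with `l₁ ≥ l₂ ≥ l₃ ≥ l₄ ≥ 0` the
square roots of the eigenvalues of `ρ ρ̃`. Here `l₁ - l₂ - l₃ - l₄` is written as twice the
largest of the four numbers minus the sum of all four. -/
def concurrence (ρ : Op 2 2) : ℝ :=
  max 0 (2 * (woottersNumbers ρ).fold max 0 - (woottersNumbers ρ).sum)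

/-- A vector of `ℂ² ⊗ ℂ²` is maximally entangled if the partial trace over Bob's system of
`|ψ⟩⟨ψ|` is `I / 2` (in particular `ψ` is then a unit vector). -/
def IsMaximallyEntangled (ψ : Fin 2 × Fin 2 → ℂ) : Prop :=
  ∀ i i' : Fin 2, ∑ j, ψ (i, j) * star (ψ (i', j)) = if i = i' then 1 / 2 else 0

/-- The fidelity (maximal singlet fraction) `F(ρ)`: the maximum of `⟨ψ|ρ|ψ⟩` over all maximally
entangled `ψ`. -/
def fidelity (ρ : Op 2 2) : ℝ :=
  sSup {f : ℝ | ∃ ψ : Fin 2 × Fin 2 → ℂ, IsMaximallyEntangled ψ ∧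
    f = (star ψ ⬝ᵥ (ρ.mulVec ψ)).re}

/-- Trace-preserving LOCC operations from `ℂ^a ⊗ ℂ^b` to `ℂ^c ⊗ ℂ^d`: protocols of finitely many
rounds. In each round one party performs a local measurement, given by finitely many Kraus operators
`K i` with `∑ i, (K i)ᴴ * K i = 1`, and announces the outcome `i` to the other party; both continue
with a protocol that may depend on `i`. The local system of the measuring party may change its
dimension (depending on the outcome), so that ancillas, isometries, discarding subsystems and
preparing new states are included. Outcomes that are finally forgotten are summed over. -/
inductive IsLOCC {c d : ℕ} : {a b : ℕ} → (Op a b → Op c d) → Prop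
  | done : IsLOCC (fun ρ : Op c d => ρ)
  | alice {a b n : ℕ} (a' : Fin n → ℕ) (K : (i : Fin n) → Matrix (Fin (a' i)) (Fin a) ℂ)
      (hK : ∑ i, (K i).conjTranspose * K i = 1)
      (next : (i : Fin n) → Op (a' i) b → Op c d) (hnext : ∀ i, IsLOCC (next i)) :
      IsLOCC fun ρ : Op a b => ∑ i, next i
        ((K i ⊗ₖ (1 : Matrix (Fin b) (Fin b) ℂ)) * ρ *
          (K i ⊗ₖ (1 : Matrix (Fin b) (Fin b) ℂ)).conjTranspose)
  | bob {a b n : ℕ} (b' : Fin n → ℕ) (K : (i : Fin n) → Matrix (Fin (b' i)) (Fin b) ℂ)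
      (hK : ∑ i, (K i).conjTranspose * K i = 1)
      (next : (i : Fin n) → Op a (b' i) → Op c d) (hnext : ∀ i, IsLOCC (next i)) :
      IsLOCC fun ρ : Op a b => ∑ i, next i
        (((1 : Matrix (Fin a) (Fin a) ℂ) ⊗ₖ K i) * ρ *
          ((1 : Matrix (Fin a) (Fin a) ℂ) ⊗ₖ K i).conjTranspose)

/-- `F*(ρ)`: the maximal fidelity that trace-preserving LOCC operations on two qubits can reach
from `ρ`. -/
def maxFidelity (ρ : Op 2 2) : ℝ :=
  sSup {f : ℝ | ∃ Λ : Op 2 2 → Op 2 2, IsLOCC Λ ∧ f = fidelity (Λ ρ)}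

end TwoQubit

end

noncomputable section

namespace TwoQubit

open Matrix

/-! ### Gram factorization and the trace pairing of positive operators -/

section PosSemidef

variable {n : Type*} [Fintype n] [DecidableEq n]

/-! Upper bound: write `ρ^Γ = P - Q` with `P, Q ≥ 0`. Partial transposition turns local Kraus maps
into local Kraus maps, so LOCC preserves such a splitting and both traces
(`IsLOCC.hasJordanTraces`). For a maximally entangled projector, `W = |ψ⟩⟨ψ|^Γ` has `W² = 1/4`;
hence `⟨ψ|σ|ψ⟩ = tr (σ^Γ W) ≤ (tr P + tr Q) / 2` (`re_expectation_le`). The Jordan decomposition of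
`ρ^Γ` gives `(1 + N) / 2`.

Lower bound: Wootters' decomposition of `ρ` into four vectors yields `⟨ψ|ρ^Γ|ψ⟩ ≥ -|det ψ| C` for
every `ψ` (`neg_norm_vecDet_mul_concurrence_le`). Product vectors thus have nonnegative expectation,
so `ρ^Γ` has at most one negative eigenvalue. If `N > 0`, that eigenvalue is `-N/2`, and its unit
eigenvector `ψ` satisfies `N ≤ 2 |det ψ| C ≤ C`. Alice filters with an operator built from `ψ`, and
failure is replaced by `|00⟩`; the fidelity reached is `(1 - 2 ⟨ψ|ρ^Γ|ψ⟩ / (1 + t)) / 2` whenever `t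
≥ 0` and `t² ≥ 1 - (2 |det ψ|)²` (`le_maxFidelity_of_expectation`). The choice `t = √(1 - (N/C)²)`
is admissible. -/

theorem exists_eq_conjTranspose_mul_self {A : Matrix n n ℂ} (hA : A.PosSemidef) :
    ∃ B : Matrix n n ℂ, A = Bᴴ * B := by
  open scoped MatrixOrder in
  obtain ⟨B, hB⟩ := CStarAlgebra.nonneg_iff_eq_star_mul_self.mp hA.nonneg
  exact ⟨B, hB⟩

theorem trace_mul_re_nonneg {A B : Matrix n n ℂ} (hA : A.PosSemidef) (hB : B.PosSemidef) :
    0 ≤ (A * B).trace.re := by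
  obtain ⟨C, rfl⟩ := exists_eq_conjTranspose_mul_self hA
  rw [Matrix.mul_assoc, Matrix.trace_mul_comm]
  exact (Complex.nonneg_iff.mp (hB.mul_mul_conjTranspose_same C).trace_nonneg).1

end PosSemidef

/-! ### Partial transposition and local Kraus operators -/

section PartialTranspose

variable {a b a' b' : ℕ}

theorem partialTranspose_sum {ι : Type*} (s : Finset ι) (f : ι → Op a b) :
    partialTranspose (∑ i ∈ s, f i) = ∑ i ∈ s, partialTranspose (f i) := by
  ext x y
  simp [partialTranspose, Matrix.sum_apply]

theorem trace_partialTranspose (ρ : Op a b) : (partialTranspose ρ).trace = ρ.trace := rfl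

theorem isHermitian_partialTranspose {ρ : Op a b} (h : ρ.IsHermitian) :
    (partialTranspose ρ).IsHermitian := by
  ext x y
  exact h.apply _ _

/-- Transposing Bob's indices in both factors only exchanges his two summation indices. -/
theorem trace_partialTranspose_mul_partialTranspose (ρ σ : Op a b) :
    (partialTranspose ρ * partialTranspose σ).trace = (ρ * σ).trace := by
  simp only [Matrix.trace, Matrix.diag_apply, Matrix.mul_apply, partialTranspose, Matrix.of_apply,
    Fintype.sum_prod_type]
  refine Finset.sum_congr rfl fun i _ => ?_
  rw [Finset.sum_comm]
  conv_rhs => rw [Finset.sum_comm]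
  refine Finset.sum_congr rfl fun k _ => ?_
  rw [Finset.sum_comm]

theorem kronecker_one_conj_apply (K : Matrix (Fin a') (Fin a) ℂ) (ρ : Op a b) (x y) :
    ((K ⊗ₖ (1 : Matrix (Fin b) (Fin b) ℂ)) * ρ *
      (K ⊗ₖ (1 : Matrix (Fin b) (Fin b) ℂ))ᴴ) x y =
      ∑ k, ∑ l, K x.1 k * ρ (k, x.2) (l, y.2) * star (K y.1 l) := by
  simp [Matrix.mul_apply, Fintype.sum_prod_type, Matrix.one_apply, Finset.sum_mul, apply_ite (starRingEnd ℂ)]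
  rw [Finset.sum_comm]

theorem one_kronecker_conj_apply (K : Matrix (Fin b') (Fin b) ℂ) (ρ : Op a b) (x y) :
    (((1 : Matrix (Fin a) (Fin a) ℂ) ⊗ₖ K) * ρ *
      ((1 : Matrix (Fin a) (Fin a) ℂ) ⊗ₖ K)ᴴ) x y =
      ∑ k, ∑ l, K x.2 k * ρ (x.1, k) (y.1, l) * star (K y.2 l) := by
  simp [Matrix.mul_apply, Fintype.sum_prod_type, Matrix.one_apply, Finset.sum_mul, apply_ite (starRingEnd ℂ)]
  rw [Finset.sum_comm]

theorem partialTranspose_kronecker_one_conj (K : Matrix (Fin a') (Fin a) ℂ) (ρ : Op a b) :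
    partialTranspose ((K ⊗ₖ (1 : Matrix (Fin b) (Fin b) ℂ)) * ρ *
      (K ⊗ₖ (1 : Matrix (Fin b) (Fin b) ℂ))ᴴ) =
    (K ⊗ₖ (1 : Matrix (Fin b) (Fin b) ℂ)) * partialTranspose ρ *
      (K ⊗ₖ (1 : Matrix (Fin b) (Fin b) ℂ))ᴴ := by
  ext x y
  simp only [partialTranspose, Matrix.of_apply, kronecker_one_conj_apply]

theorem partialTranspose_one_kronecker_conj (K : Matrix (Fin b') (Fin b) ℂ) (ρ : Op a b) :
    partialTranspose (((1 : Matrix (Fin a) (Fin a) ℂ) ⊗ₖ K) * ρ *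
      ((1 : Matrix (Fin a) (Fin a) ℂ) ⊗ₖ K)ᴴ) =
    ((1 : Matrix (Fin a) (Fin a) ℂ) ⊗ₖ K.map star) * partialTranspose ρ *
      ((1 : Matrix (Fin a) (Fin a) ℂ) ⊗ₖ K.map star)ᴴ := by
  ext x y
  simp only [partialTranspose, Matrix.of_apply, one_kronecker_conj_apply, Matrix.map_apply,
    star_star]
  rw [Finset.sum_comm]
  refine Finset.sum_congr rfl fun k _ => Finset.sum_congr rfl fun l _ => by ring

theorem conjTranspose_mul_self_map_star (K : Matrix (Fin b') (Fin b) ℂ) :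
    (K.map star)ᴴ * K.map star = (Kᴴ * K).map star := by
  ext i j
  simp [Matrix.mul_apply, map_sum]

end PartialTranspose

/-! ### LOCC monotonicity of splittings of `ρ^Γ` -/

theorem sum_trace_conj {ι m : Type*} [Fintype ι] [Fintype m] [DecidableEq m] {k : ι → Type*}
    [∀ i, Fintype (k i)] (K : (i : ι) → Matrix (k i) m ℂ) (hK : ∑ i, (K i)ᴴ * K i = 1)
    (P : Matrix m m ℂ) : ∑ i, (K i * P * (K i)ᴴ).trace = P.trace := by
  have h : ∀ i, (K i * P * (K i)ᴴ).trace = ((K i)ᴴ * K i * P).trace := fun i => by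
    rw [Matrix.trace_mul_comm, Matrix.mul_assoc]
  simp_rw [h, ← Matrix.trace_sum, ← Finset.sum_mul, hK, one_mul]

/-- `ρ^Γ` is the difference of two positive semidefinite operators with traces `p` and `q`. -/
def HasJordanTraces {a b : ℕ} (ρ : Op a b) (p q : ℂ) : Prop :=
  ∃ P Q : Op a b, P.PosSemidef ∧ Q.PosSemidef ∧ partialTranspose ρ = P - Q ∧
    P.trace = p ∧ Q.trace = q

theorem HasJordanTraces.sum {a b k : ℕ} {ρ : Fin k → Op a b} {p q : Fin k → ℂ}
    (h : ∀ i, HasJordanTraces (ρ i) (p i) (q i)) :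
    HasJordanTraces (∑ i, ρ i) (∑ i, p i) (∑ i, q i) := by
  choose P Q hP hQ hPQ hp hq using h
  refine ⟨∑ i, P i, ∑ i, Q i, Matrix.posSemidef_sum _ fun i _ => hP i,
    Matrix.posSemidef_sum _ fun i _ => hQ i, ?_, ?_, ?_⟩
  · simp_rw [partialTranspose_sum, hPQ, Finset.sum_sub_distrib]
  · simp_rw [Matrix.trace_sum, hp]
  · simp_rw [Matrix.trace_sum, hq]

/-- In each round `Γ` moves past the Kraus operators, conjugated entrywise on Bob's side. Branches
stay differences of positive operators, and completeness makes their traces add up to the original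
ones. -/
theorem IsLOCC.hasJordanTraces {a b c d : ℕ} {Λ : Op a b → Op c d} (hΛ : IsLOCC Λ) :
    ∀ {ρ : Op a b} {p q : ℂ}, HasJordanTraces ρ p q → HasJordanTraces (Λ ρ) p q := by
  induction hΛ with
  | done => exact fun h => h
  | @alice a b _ a' K hK next _ ih =>
    rintro ρ _ _ ⟨P, Q, hP, hQ, h, rfl, rfl⟩
    have hK' : ∑ i, (K i ⊗ₖ (1 : Matrix (Fin b) (Fin b) ℂ))ᴴ *
        (K i ⊗ₖ (1 : Matrix (Fin b) (Fin b) ℂ)) = 1 := by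
      simp_rw [Matrix.conjTranspose_kronecker, ← Matrix.mul_kronecker_mul,
        Matrix.conjTranspose_one, one_mul]
      rw [← Matrix.one_kronecker_one, ← hK]
      ext x y
      simp [Matrix.sum_apply, Finset.sum_mul]
    rw [← sum_trace_conj _ hK' P, ← sum_trace_conj _ hK' Q]
    refine HasJordanTraces.sum fun i => ih i ⟨_, _, hP.mul_mul_conjTranspose_same _,
      hQ.mul_mul_conjTranspose_same _, ?_, rfl, rfl⟩
    rw [partialTranspose_kronecker_one_conj, h, Matrix.mul_sub, Matrix.sub_mul]
  | @bob a b _ b' K hK next _ ih =>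
    rintro ρ _ _ ⟨P, Q, hP, hQ, h, rfl, rfl⟩
    have hK' : ∑ i, ((1 : Matrix (Fin a) (Fin a) ℂ) ⊗ₖ (K i).map star)ᴴ *
        ((1 : Matrix (Fin a) (Fin a) ℂ) ⊗ₖ (K i).map star) = 1 := by
      simp_rw [Matrix.conjTranspose_kronecker, ← Matrix.mul_kronecker_mul,
        Matrix.conjTranspose_one, one_mul, conjTranspose_mul_self_map_star]
      have hK2 : ∑ i, ((K i)ᴴ * K i).map star = 1 := by
        ext x y
        have := congrArg star (congrFun₂ hK x y)
        rw [Matrix.sum_apply, star_sum] at this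
        simp only [Matrix.sum_apply, Matrix.map_apply]
        rw [this, Matrix.one_apply]
        split_ifs <;> simp
      rw [← Matrix.one_kronecker_one, ← hK2]
      ext x y
      simp [Matrix.sum_apply, Finset.mul_sum]
    rw [← sum_trace_conj _ hK' P, ← sum_trace_conj _ hK' Q]
    refine HasJordanTraces.sum fun i => ih i ⟨_, _, hP.mul_mul_conjTranspose_same _,
      hQ.mul_mul_conjTranspose_same _, ?_, rfl, rfl⟩
    rw [partialTranspose_one_kronecker_conj, h, Matrix.mul_sub, Matrix.sub_mul]

/-! ### Upper bound on the fidelity -/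

section Fidelity

/-- Up to local unitaries the partial transpose is half the swap; in entries, its square is the
product of the two reduced states. -/
theorem partialTranspose_sq_of_isMaximallyEntangled {ψ : Fin 2 × Fin 2 → ℂ}
    (h : IsMaximallyEntangled ψ) :
    partialTranspose (Matrix.vecMulVec ψ (star ψ)) * partialTranspose (Matrix.vecMulVec ψ (star ψ))
      = (1 / 4 : ℂ) • (1 : Op 2 2) := by
  set M : Matrix (Fin 2) (Fin 2) ℂ := Matrix.of fun i j => ψ (i, j) with hM
  have h1 : M * ((2 : ℂ) • Mᴴ) = 1 := by
    ext i j
    have := h i j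
    rw [Matrix.mul_smul, Matrix.smul_apply, Matrix.mul_apply]
    simp only [Matrix.conjTranspose_apply, hM, Matrix.of_apply, this, Matrix.one_apply]
    split_ifs <;> simp
  -- A one-sided inverse of a square matrix is two-sided: Bob's reduced state is `I / 2` as well.
  have h2 := mul_eq_one_comm.mp h1
  have h3 : ∀ i j, ∑ k, star (ψ (k, i)) * ψ (k, j) = if i = j then 1 / 2 else 0 := fun i j => by
    have := congrFun₂ h2 i j
    rw [Matrix.smul_mul, Matrix.smul_apply, Matrix.mul_apply] at this
    simp only [Matrix.conjTranspose_apply, hM, Matrix.of_apply, Matrix.one_apply,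
      smul_eq_mul] at this
    split_ifs at this ⊢
    · rw [eq_div_iff two_ne_zero, mul_comm, this]
    · exact (mul_eq_zero.mp this).resolve_left two_ne_zero
  ext x y
  simp only [Matrix.mul_apply, partialTranspose, Matrix.of_apply, Matrix.vecMulVec_apply,
    Pi.star_apply, Fintype.sum_prod_type, Matrix.smul_apply, smul_eq_mul]
  calc _ = (∑ n, ψ (x.1, n) * star (ψ (y.1, n))) * ∑ m, star (ψ (m, x.2)) * ψ (m, y.2) := by
        rw [Finset.sum_mul_sum, Finset.sum_comm]
        refine Finset.sum_congr rfl fun k _ => Finset.sum_congr rfl fun l _ => by ring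
    _ = _ := by
        rw [h, h3, Matrix.one_apply]
        simp only [Prod.ext_iff, ite_and]
        split_ifs <;> norm_num

theorem re_expectation_le {σ : Op 2 2} {p q : ℂ} (hσ : HasJordanTraces σ p q)
    {ψ : Fin 2 × Fin 2 → ℂ} (h : IsMaximallyEntangled ψ) :
    (star ψ ⬝ᵥ σ.mulVec ψ).re ≤ 1 / 2 * (p.re + q.re) := by
  obtain ⟨P, Q, hP, hQ, hPQ, rfl, rfl⟩ := hσ
  set W := partialTranspose (Matrix.vecMulVec ψ (star ψ)) with hW
  have hWh : W.IsHermitian :=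
    isHermitian_partialTranspose (Matrix.posSemidef_vecMulVec_self_star ψ).isHermitian
  have hsq : W * W = (1 / 4 : ℂ) • (1 : Op 2 2) := partialTranspose_sq_of_isMaximallyEntangled h
  -- Since `W² = 1/4`, the Hermitian operator `1/2 ± W` equals its own square.
  have key : ∀ s : ℝ, s ^ 2 = 1 → ((1 / 2 : ℂ) • (1 : Op 2 2) + (s : ℂ) • W).PosSemidef := by
    intro s hs
    have hh : ((1 / 2 : ℂ) • (1 : Op 2 2) + (s : ℂ) • W)ᴴ =
        (1 / 2 : ℂ) • (1 : Op 2 2) + (s : ℂ) • W := by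
      rw [Matrix.conjTranspose_add, Matrix.conjTranspose_smul, Matrix.conjTranspose_smul, hWh.eq]
      simp
    have hs' : (s : ℂ) ^ 2 = 1 := by exact_mod_cast hs
    have : (1 / 2 : ℂ) • (1 : Op 2 2) + (s : ℂ) • W =
        ((1 / 2 : ℂ) • (1 : Op 2 2) + (s : ℂ) • W)ᴴ * ((1 / 2 : ℂ) • (1 : Op 2 2) + (s : ℂ) • W) := by
      rw [hh]
      simp only [add_mul, mul_add, Matrix.smul_mul, Matrix.mul_smul, one_mul, mul_one, hsq, smul_smul]
      rw [show (s : ℂ) * (s * (1 / 4)) = 1 / 4 by linear_combination 1 / 4 * hs']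
      module
    rw [this]
    exact Matrix.posSemidef_conjTranspose_mul_self _
  have e : star ψ ⬝ᵥ σ.mulVec ψ = (P * W).trace - (Q * W).trace := by
    rw [← Matrix.trace_sub, ← sub_mul, ← hPQ, hW, trace_partialTranspose_mul_partialTranspose,
      Matrix.mul_vecMulVec, Matrix.trace_vecMulVec, dotProduct_comm]
  have h1 := trace_mul_re_nonneg hP (key (-1) (by norm_num))
  have h2 := trace_mul_re_nonneg hQ (key 1 (by norm_num))
  simp [mul_add, Matrix.trace_add] at h1 h2
  rw [e, Complex.sub_re]
  linarith

/-- Needed for lower bounds: `sSup` of an unbounded set of reals would be the default value `0`. -/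
theorem bddAbove_fidelity {σ : Op 2 2} {p q : ℂ} (hσ : HasJordanTraces σ p q) :
    BddAbove {f : ℝ | ∃ ψ : Fin 2 × Fin 2 → ℂ, IsMaximallyEntangled ψ ∧
      f = (star ψ ⬝ᵥ (σ.mulVec ψ)).re} :=
  ⟨_, by rintro _ ⟨ψ, h, rfl⟩; exact re_expectation_le hσ h⟩

/-- The maximally entangled vector `(|00⟩ + |11⟩) / √2`. -/
def bellVector : Fin 2 × Fin 2 → ℂ := fun x => if x.1 = x.2 then (Real.sqrt 2 / 2 : ℝ) else 0

theorem sqrt_two_div_two_mul_self :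
    ((Real.sqrt 2 / 2 : ℝ) : ℂ) * ((Real.sqrt 2 / 2 : ℝ) : ℂ) = 1 / 2 := by
  rw [← Complex.ofReal_mul, div_mul_div_comm, Real.mul_self_sqrt two_pos.le]
  norm_num

theorem isMaximallyEntangled_bellVector : IsMaximallyEntangled bellVector := by
  intro i j
  have := sqrt_two_div_two_mul_self
  fin_cases i <;> fin_cases j <;> simp [bellVector, -Complex.ofReal_div] <;> simpa using this

theorem fidelity_le {σ : Op 2 2} {p q : ℂ} (hσ : HasJordanTraces σ p q) :
    fidelity σ ≤ 1 / 2 * (p.re + q.re) :=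
  csSup_le ⟨_, bellVector, isMaximallyEntangled_bellVector, rfl⟩
    (by rintro _ ⟨ψ, h, rfl⟩; exact re_expectation_le hσ h)

theorem bddAbove_maxFidelity {ρ : Op 2 2} {p q : ℂ} (hρ : HasJordanTraces ρ p q) :
    BddAbove {f : ℝ | ∃ Λ : Op 2 2 → Op 2 2, IsLOCC Λ ∧ f = fidelity (Λ ρ)} :=
  ⟨_, by rintro _ ⟨Λ, h, rfl⟩; exact fidelity_le (h.hasJordanTraces hρ)⟩

theorem maxFidelity_le {ρ : Op 2 2} {p q : ℂ} (hρ : HasJordanTraces ρ p q) :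
    maxFidelity ρ ≤ 1 / 2 * (p.re + q.re) :=
  csSup_le ⟨_, _, IsLOCC.done, rfl⟩
    (by rintro _ ⟨Λ, h, rfl⟩; exact fidelity_le (h.hasJordanTraces hρ))

theorem le_maxFidelity {ρ : Op 2 2} {p q : ℂ} (hρ : HasJordanTraces ρ p q) {Λ : Op 2 2 → Op 2 2}
    (hΛ : IsLOCC Λ) {ψ : Fin 2 × Fin 2 → ℂ} (hψ : IsMaximallyEntangled ψ) :
    (star ψ ⬝ᵥ (Λ ρ).mulVec ψ).re ≤ maxFidelity ρ :=
  (le_csSup (bddAbove_fidelity (hΛ.hasJordanTraces hρ)) ⟨ψ, hψ, rfl⟩).trans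
    (le_csSup (bddAbove_maxFidelity hρ) ⟨Λ, hΛ, rfl⟩)

end Fidelity

/-! ### Takagi factorization through symmetric antilinear maps -/

section Takagi

open scoped InnerProductSpace

variable {E : Type*} [NormedAddCommGroup E] [InnerProductSpace ℂ E] [FiniteDimensional ℂ E]

/-- A symmetric antilinear map has a unit vector which it maps to a nonnegative multiple of itself
in every nontrivial invariant subspace. -/
theorem exists_coneigenvector (T : E →ₗ⋆[ℂ] E) (hT : ∀ x y, ⟪x, T y⟫_ℂ = ⟪y, T x⟫_ℂ)
    (W : Submodule ℂ E) (hW : ∀ x ∈ W, T x ∈ W) (hne : W ≠ ⊥) :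
    ∃ z ∈ W, ‖z‖ = 1 ∧ ∃ s : ℝ, 0 ≤ s ∧ T z = (s : ℂ) • z := by
  have hnt : Nontrivial W := Submodule.nontrivial_iff_ne_bot.mpr hne
  let f : W →ₗ[ℂ] W := (T.comp T).restrict fun x hx => hW _ (hW x hx)
  obtain ⟨μ, hμ⟩ := Module.End.exists_eigenvalue f
  obtain ⟨⟨x, hxW⟩, hx⟩ := hμ.exists_hasEigenvector
  have hx0 : x ≠ 0 := fun h => hx.2 (Subtype.ext h)
  have hxx : T (T x) = μ • x := congrArg Subtype.val hx.apply_eq_smul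
  have hnx : ‖x‖ ≠ 0 := norm_ne_zero_iff.mpr hx0
  -- Symmetry gives `μ ‖x‖² = ⟪x, T (T x)⟫ = ‖T x‖²`, so `μ = s²`.
  set s : ℝ := ‖T x‖ / ‖x‖ with hs
  have hμs : μ = (s : ℂ) * s := by
    have h := hT x (T x)
    rw [hxx, inner_smul_right, inner_self_eq_norm_sq_to_K, inner_self_eq_norm_sq_to_K] at h
    have hnx' : (‖x‖ : ℂ) ≠ 0 := by exact_mod_cast hnx
    rw [hs]
    push_cast
    field_simp
    exact h
  have hs0 : 0 ≤ s := by positivity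
  -- As `T² x = s² x`, the vector `T x + s x` works unless it is zero; then `T x = -s x`, and
  -- antilinearity flips the sign on `i x`.
  obtain ⟨z, hzW, hz0, hz⟩ : ∃ z ∈ W, z ≠ 0 ∧ T z = (s : ℂ) • z := by
    by_cases h : T x + (s : ℂ) • x = 0
    · refine ⟨Complex.I • x, W.smul_mem _ hxW, smul_ne_zero Complex.I_ne_zero hx0, ?_⟩
      rw [map_smulₛₗ, eq_neg_of_add_eq_zero_left h, smul_neg, smul_smul, smul_smul, ← neg_smul]
      simp [mul_comm]
    · refine ⟨_, W.add_mem (hW x hxW) (W.smul_mem _ hxW), h, ?_⟩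
      rw [map_add, map_smulₛₗ, hxx, hμs, smul_add, smul_smul, Complex.conj_ofReal, add_comm]
  have hnz : ‖z‖ ≠ 0 := norm_ne_zero_iff.mpr hz0
  refine ⟨((‖z‖⁻¹ : ℝ) : ℂ) • z, W.smul_mem _ hzW, ?_, s, hs0, ?_⟩
  · rw [norm_smul, Complex.norm_real, norm_inv, norm_norm, inv_mul_cancel₀ hnz]
  · rw [map_smulₛₗ, hz, Complex.conj_ofReal, smul_comm]

/-- By symmetry of `T`, the orthogonal complement of the vectors already found is invariant, so
another one can be split off. -/
theorem exists_orthonormal_coneigenvectors (T : E →ₗ⋆[ℂ] E)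
    (hT : ∀ x y, ⟪x, T y⟫_ℂ = ⟪y, T x⟫_ℂ) :
    ∀ k ≤ Module.finrank ℂ E, ∃ v : Fin k → E, Orthonormal ℂ v ∧
      ∃ s : Fin k → ℝ, ∀ i, 0 ≤ s i ∧ T (v i) = (s i : ℂ) • v i := by
  intro k
  induction k with
  | zero => exact fun _ => ⟨Fin.elim0, ⟨fun i => i.elim0, fun i => i.elim0⟩, Fin.elim0,
      fun i => i.elim0⟩
  | succ k ih =>
    intro hk
    obtain ⟨v, hv, s, hs⟩ := ih (by omega)
    set V := Submodule.span ℂ (Set.range v) with hV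
    have hmem : ∀ x, x ∈ Vᗮ ↔ ∀ i, ⟪v i, x⟫_ℂ = 0 := fun x => by
      rw [hV, Submodule.mem_orthogonal]
      refine ⟨fun h i => h _ (Submodule.subset_span ⟨i, rfl⟩), fun h u hu => ?_⟩
      induction hu using Submodule.span_induction with
      | mem y hy => obtain ⟨i, rfl⟩ := hy; exact h i
      | zero => simp
      | add y z _ _ hy hz => rw [inner_add_left, hy, hz, add_zero]
      | smul c y _ hy => rw [inner_smul_left, hy, mul_zero]
    have hW : ∀ x ∈ Vᗮ, T x ∈ Vᗮ := fun x hx => by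
      rw [hmem] at hx ⊢
      intro i
      rw [hT, (hs i).2, inner_smul_right, ← inner_conj_symm, hx i]
      simp
    have hne : Vᗮ ≠ ⊥ := by
      intro h
      have h1 : V = ⊤ := (Submodule.orthogonal_eq_bot_iff).mp h
      have h2 := finrank_span_eq_card hv.linearIndependent
      rw [← hV, h1, finrank_top, Fintype.card_fin] at h2
      omega
    obtain ⟨z, hzW, hz1, t, ht, hz⟩ := exists_coneigenvector T hT Vᗮ hW hne
    refine ⟨Matrix.vecCons z v, orthonormal_vecCons_iff.mpr ⟨hz1, fun i => ?_, hv⟩,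
      Matrix.vecCons t s, Fin.cases ⟨ht, hz⟩ hs⟩
    rw [← inner_conj_symm, (hmem z).mp hzW i, map_zero]

/-- The antilinear map `x ↦ conj (τ x)` is symmetric because `τ` is; its coneigenvectors are the
columns of `U`. -/
theorem exists_takagi {n : Type*} [Fintype n] [DecidableEq n] {k : ℕ} (hk : Fintype.card n = k)
    (τ : Matrix n n ℂ) (hτ : τᵀ = τ) :
    ∃ (U : Matrix n (Fin k) ℂ) (s : Fin k → ℝ), Uᴴ * U = 1 ∧ U * Uᴴ = 1 ∧ (∀ i, 0 ≤ s i) ∧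
      Uᵀ * τ * U = Matrix.diagonal fun i => (s i : ℂ) := by
  let T : EuclideanSpace ℂ n →ₗ⋆[ℂ] EuclideanSpace ℂ n :=
    { toFun := fun x => WithLp.toLp 2 (star (τ *ᵥ x.ofLp))
      map_add' := fun x y => by
        ext i; simp [Matrix.mulVec_add]
      map_smul' := fun c x => by
        ext i; simp [Matrix.mulVec_smul] }
  have hin : ∀ x y, ⟪x, T y⟫_ℂ = star (x.ofLp ⬝ᵥ τ *ᵥ y.ofLp) := fun x y => by
    rw [EuclideanSpace.inner_eq_star_dotProduct, ← Matrix.star_dotProduct_star, dotProduct_comm]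
    simp [T, dotProduct_comm]
  have hT : ∀ x y, ⟪x, T y⟫_ℂ = ⟪y, T x⟫_ℂ := fun x y => by
    rw [hin, hin, Matrix.dotProduct_mulVec, ← Matrix.mulVec_transpose, hτ, dotProduct_comm]
  obtain ⟨v, hv, s, hs⟩ := exists_orthonormal_coneigenvectors T hT k (by simp [hk])
  have hv' := orthonormal_iff_ite.mp hv
  set U : Matrix n (Fin k) ℂ := Matrix.of fun i j => v j i with hU
  have hU1 : Uᴴ * U = 1 := by
    ext i j
    rw [Matrix.one_apply, ← hv', EuclideanSpace.inner_eq_star_dotProduct, dotProduct_comm]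
    rfl
  have hU2 : U * Uᴴ = 1 :=
    (mul_eq_one_comm_of_equiv (Fintype.equivFinOfCardEq hk).symm).mp hU1
  refine ⟨U, s, hU1, hU2, fun i => (hs i).1, ?_⟩
  have h : τ * U = U.map star * Matrix.diagonal fun i => (s i : ℂ) := by
    ext i j
    have := congrArg star (congrArg (fun x => x.ofLp i) (hs j).2)
    simp only [T, LinearMap.coe_mk, AddHom.coe_mk, Pi.star_apply, star_star, PiLp.smul_apply,
      smul_eq_mul, star_mul'] at this
    rw [Matrix.mul_diagonal, Matrix.map_apply, mul_comm]
    simpa [hU, Matrix.mul_apply, Matrix.mulVec, dotProduct] using this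
  have h' : Uᵀ * U.map star = 1 := by
    have := congrArg Matrix.transpose hU1
    rwa [Matrix.transpose_mul, Matrix.transpose_one] at this
  rw [Matrix.mul_assoc, h, ← Matrix.mul_assoc, h', one_mul]

end Takagi

/-! ### Minimizing a sum of four numbers with free phases -/

section Phases

theorem exists_norm_add_mul_eq {a b s : ℝ} (hb : 0 ≤ b) (hba : b ≤ a) (h1 : a - b ≤ s)
    (h2 : s ≤ a + b) : ∃ u : ℂ, ‖u‖ = 1 ∧ ‖(a : ℂ) + u * b‖ = s := by
  have hcont : ContinuousOn (fun θ : ℝ => ‖(a : ℂ) + Complex.exp (θ * Complex.I) * b‖)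
      (Set.Icc 0 Real.pi) := by fun_prop
  have hs : s ∈ Set.Icc ‖(a : ℂ) + Complex.exp ((Real.pi : ℝ) * Complex.I) * b‖
      ‖(a : ℂ) + Complex.exp ((0 : ℝ) * Complex.I) * b‖ := by
    rw [Complex.exp_pi_mul_I, Complex.ofReal_zero, zero_mul, Complex.exp_zero, one_mul,
      neg_one_mul, ← sub_eq_add_neg, ← Complex.ofReal_sub, ← Complex.ofReal_add,
      Complex.norm_of_nonneg (by linarith), Complex.norm_of_nonneg (by linarith)]
    exact ⟨h1, h2⟩
  obtain ⟨θ, _, hθ⟩ := intermediate_value_Icc' Real.pi_pos.le hcont hs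
  exact ⟨_, Complex.norm_exp_ofReal_mul_I θ, hθ⟩

/-- If `a` dominates, all phases are opposed to it. Otherwise the quadrilateral closes: tune `‖a + u
b‖` to `c + d` by continuity, then point `c` and `d` jointly against it. -/
theorem exists_phases_of_le {a b c d : ℝ} (hd : 0 ≤ d) (hdc : d ≤ c) (hcb : c ≤ b) (hba : b ≤ a) :
    ∃ u v w : ℂ, ‖u‖ = 1 ∧ ‖v‖ = 1 ∧ ‖w‖ = 1 ∧
      ‖(a : ℂ) + u * b + v * c + w * d‖ ≤ max 0 (a - b - c - d) := by
  rcases le_or_gt (b + c + d) a with h | h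
  · refine ⟨-1, -1, -1, by simp, by simp, by simp, le_max_of_le_right (le_of_eq ?_)⟩
    rw [show (a : ℂ) + -1 * b + -1 * c + -1 * d = ((a - b - c - d : ℝ) : ℂ) by push_cast; ring]
    exact Complex.norm_of_nonneg (by linarith)
  · obtain ⟨u, hu, hs⟩ := exists_norm_add_mul_eq (hd.trans (hdc.trans hcb)) hba
      (s := c + d) (by linarith) (by linarith)
    have hcd : 0 < c + d := by linarith
    have hcd' : (c : ℂ) + d ≠ 0 := by exact_mod_cast hcd.ne'
    set v : ℂ := -((a : ℂ) + u * b) / (c + d) with hv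
    have hv1 : ‖v‖ = 1 := by
      rw [hv, norm_div, norm_neg, hs, ← Complex.ofReal_add, Complex.norm_of_nonneg hcd.le,
        div_self hcd.ne']
    refine ⟨u, v, v, hu, hv1, hv1, le_max_of_le_left (le_of_eq ?_)⟩
    rw [norm_eq_zero, hv]
    field_simp
    ring

theorem exists_phases (σ : Fin 4 → ℝ) (hσ : ∀ j, 0 ≤ σ j) {M : ℝ} (hM : ∀ j, σ j ≤ M) :
    ∃ w : Fin 4 → ℂ, (∀ j, ‖w j‖ = 1) ∧ ‖∑ j, w j * σ j‖ ≤ max 0 (2 * M - ∑ j, σ j) := by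
  set π := Tuple.sort σ
  have hm : Monotone (σ ∘ π) := Tuple.monotone_sort σ
  obtain ⟨u, v, w, hu, hv, hw, h⟩ := exists_phases_of_le (hσ (π 0))
    (hm (show (0 : Fin 4) ≤ 1 by decide)) (hm (show (1 : Fin 4) ≤ 2 by decide))
    (hm (show (2 : Fin 4) ≤ 3 by decide))
  have h1 : ∀ i, ‖![w, v, u, 1] i‖ = 1 := fun i => by
    fin_cases i <;> simp [hu, hv, hw]
  refine ⟨fun j => ![w, v, u, 1] (π.symm j), fun j => h1 _, ?_⟩
  · rw [← Equiv.sum_comp π, ← Equiv.sum_comp π σ]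
    simp only [Equiv.symm_apply_apply, Fin.sum_univ_four]
    refine le_trans (le_of_eq ?_) (h.trans (max_le_max le_rfl ?_))
    · congr 1
      simp
      ring
    · have := hM (π 3)
      simp only [Function.comp_apply]
      linarith

end Phases

/-! ### Wootters' decomposition and the bound on `ρ^Γ` -/

section Concurrence

theorem sigmaY_kronecker_transpose : (sigmaY ⊗ₖ sigmaY)ᵀ = sigmaY ⊗ₖ sigmaY := by
  ext ⟨i, j⟩ ⟨k, l⟩
  fin_cases i <;> fin_cases j <;> fin_cases k <;> fin_cases l <;> simp [sigmaY]

theorem sigmaY_kronecker_map_star : (sigmaY ⊗ₖ sigmaY).map star = sigmaY ⊗ₖ sigmaY := by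
  ext ⟨i, j⟩ ⟨k, l⟩
  fin_cases i <;> fin_cases j <;> fin_cases k <;> fin_cases l <;> simp [sigmaY]

/-- The determinant of the coefficient matrix of a two-qubit vector. -/
def vecDet (φ : Fin 2 × Fin 2 → ℂ) : ℂ := φ (0, 0) * φ (1, 1) - φ (0, 1) * φ (1, 0)

theorem sigmaY_quadratic_apply {k : Type*} (Z : Matrix (Fin 2 × Fin 2) k ℂ) (i : k) :
    (Zᵀ * (sigmaY ⊗ₖ sigmaY) * Z) i i = -2 * vecDet fun x => Z x i := by
  simp [Matrix.mul_apply, Fintype.sum_prod_type, sigmaY, vecDet]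
  ring

/-- Any unitary mixing of the columns of a square root of `ρ` again decomposes `ρ`; Takagi's unitary
diagonalizes the symmetric form `σ_y ⊗ σ_y` on them. -/
theorem exists_sigmaY_diagonal {ρ : Op 2 2} (hρ : ρ.PosSemidef) :
    ∃ (Y : Matrix (Fin 2 × Fin 2) (Fin 4) ℂ) (s : Fin 4 → ℝ), ρ = Y * Yᴴ ∧ (∀ i, 0 ≤ s i) ∧
      Yᵀ * (sigmaY ⊗ₖ sigmaY) * Y = Matrix.diagonal fun i => (s i : ℂ) := by
  obtain ⟨B, hB⟩ := exists_eq_conjTranspose_mul_self hρ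
  obtain ⟨U, s, _, hU, hs, hd⟩ := exists_takagi (k := 4) (by simp)
    ((Bᴴ)ᵀ * (sigmaY ⊗ₖ sigmaY) * Bᴴ) (by
      rw [Matrix.transpose_mul, Matrix.transpose_mul, sigmaY_kronecker_transpose,
        Matrix.transpose_transpose, Matrix.mul_assoc])
  refine ⟨Bᴴ * U, s, ?_, hs, ?_⟩
  · rw [Matrix.conjTranspose_mul, Matrix.conjTranspose_conjTranspose, Matrix.mul_assoc,
      ← Matrix.mul_assoc U, hU, one_mul, hB]
  · rw [← hd, Matrix.transpose_mul]
    simp only [Matrix.mul_assoc]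

theorem woottersNumbers_eq {Y : Matrix (Fin 2 × Fin 2) (Fin 4) ℂ} {s : Fin 4 → ℝ}
    (hs : ∀ i, 0 ≤ s i)
    (h : Yᵀ * (sigmaY ⊗ₖ sigmaY) * Y = Matrix.diagonal fun i => (s i : ℂ)) :
    woottersNumbers (Y * Yᴴ) = Finset.univ.val.map s := by
  have h1 : (Y * Yᴴ).map star = Y.map star * Yᵀ := by
    ext i j
    simp [Matrix.mul_apply, map_sum]
  have h2 : Yᴴ * (sigmaY ⊗ₖ sigmaY) * Y.map star = Matrix.diagonal fun i => (s i : ℂ) := by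
    have := congrArg Matrix.conjTranspose h
    rw [Matrix.diagonal_conjTranspose, Matrix.conjTranspose_mul, Matrix.conjTranspose_mul,
      ← Matrix.mul_assoc] at this
    rw [show (Yᵀ)ᴴ = Y.map star from rfl] at this
    have h3 : (sigmaY ⊗ₖ sigmaY)ᴴ = sigmaY ⊗ₖ sigmaY := by
      rw [Matrix.conjTranspose, sigmaY_kronecker_transpose, sigmaY_kronecker_map_star]
    rw [h3] at this
    rw [this]
    congr 1
    ext i
    simp
  have h3 : (Y * Yᴴ * spinFlip (Y * Yᴴ)).charpoly =
      (Matrix.diagonal fun i => ((s i ^ 2 : ℝ) : ℂ)).charpoly := by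
    have e : Y * Yᴴ * spinFlip (Y * Yᴴ) =
        Y * (Yᴴ * (sigmaY ⊗ₖ sigmaY) * Y.map star * (Yᵀ * (sigmaY ⊗ₖ sigmaY))) := by
      rw [spinFlip, h1]
      simp only [Matrix.mul_assoc]
    rw [e, h2]
    -- Cycling `Y` to the back turns `ρ ρ̃` into the square of the diagonal matrix of the `s i`,
    -- with the same characteristic polynomial.
    have := Matrix.charpoly_mul_comm_of_le Y
      ((Matrix.diagonal fun i => (s i : ℂ)) * (Yᵀ * (sigmaY ⊗ₖ sigmaY))) (by simp)
    rw [this, Matrix.mul_assoc, h, Matrix.diagonal_mul_diagonal]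
    simp [pow_two]
  rw [woottersNumbers, eigenvalueMultiset, h3, Matrix.charpoly_diagonal, Polynomial.roots_prod]
  · simp only [Polynomial.roots_X_sub_C, Multiset.bind_singleton, Multiset.map_map]
    refine Multiset.map_congr rfl fun i _ => ?_
    rw [Function.comp_apply, Complex.ofReal_re, Real.sqrt_sq (hs i)]
  · exact Finset.prod_ne_zero_iff.mpr fun i _ => Polynomial.X_sub_C_ne_zero _

/-- The orthogonal `4 × 4` matrix with entries `± 1 / 2`. -/
def halfHadamard : Matrix (Fin 4) (Fin 4) ℂ :=
  (1 / 2 : ℂ) • !![1, 1, 1, 1; 1, 1, -1, -1; 1, -1, 1, -1; 1, -1, -1, 1]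

theorem halfHadamard_mul_conjTranspose : halfHadamard * halfHadamardᴴ = 1 := by
  ext i j
  fin_cases i <;> fin_cases j <;>
    simp [halfHadamard, Matrix.mul_apply, Fin.sum_univ_four, map_ofNat] <;> norm_num

theorem halfHadamard_apply_sq (i j : Fin 4) : halfHadamard i j ^ 2 = 1 / 4 := by
  fin_cases i <;> fin_cases j <;> simp [halfHadamard] <;> norm_num

theorem le_fold_max (s : Multiset ℝ) {x : ℝ} (hx : x ∈ s) : x ≤ s.fold max 0 := by
  induction s using Multiset.induction_on with
  | empty => simp at hx
  | cons a s ih =>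
    rw [Multiset.fold_cons_left]
    rcases Multiset.mem_cons.mp hx with rfl | h
    · exact le_max_left _ _
    · exact (ih h).trans (le_max_right _ _)

/-- Phases `e j` with `e j ^ 2 = w j` shrink `∑ w j s j` to at most the concurrence; mixing with
entries `±1/2` then gives every vector the same value, a quarter of that sum. -/
theorem exists_decomposition_sum_norm_vecDet_le {ρ : Op 2 2} (hρ : ρ.PosSemidef) :
    ∃ Z : Matrix (Fin 2 × Fin 2) (Fin 4) ℂ, ρ = Z * Zᴴ ∧
      ∑ i, 2 * ‖vecDet fun x => Z x i‖ ≤ concurrence ρ := by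
  obtain ⟨Y, s, hY, hs, hd⟩ := exists_sigmaY_diagonal hρ
  have hw := woottersNumbers_eq hs hd
  rw [← hY] at hw
  obtain ⟨w, hw1, hsum⟩ := exists_phases s hs (M := (woottersNumbers ρ).fold max 0)
    fun j => le_fold_max _ (by rw [hw]; exact Multiset.mem_map_of_mem s (Finset.mem_univ j))
  have hr : ∀ j, ∃ e : ℂ, e ^ 2 = w j := fun j => IsAlgClosed.exists_pow_nat_eq _ two_pos
  choose e he using hr
  have he1 : ∀ j, ‖e j‖ = 1 := fun j => by
    have := congrArg norm (he j)
    rw [norm_pow, hw1] at this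
    exact (pow_eq_one_iff_of_nonneg (norm_nonneg _) two_ne_zero).mp this
  have hee : Matrix.diagonal e * (Matrix.diagonal e)ᴴ = 1 := by
    rw [Matrix.diagonal_conjTranspose, Matrix.diagonal_mul_diagonal, ← Matrix.diagonal_one]
    congr 1
    ext j
    rw [Pi.star_apply, Complex.star_def, Complex.mul_conj, Complex.normSq_eq_norm_sq, he1]
    simp
  set Z := Y * (Matrix.diagonal e * halfHadamard) with hZ
  refine ⟨Z, ?_, ?_⟩
  · rw [hZ, Matrix.conjTranspose_mul, Matrix.conjTranspose_mul, hY]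
    simp only [Matrix.mul_assoc]
    rw [← Matrix.mul_assoc halfHadamard, halfHadamard_mul_conjTranspose, Matrix.one_mul,
      ← Matrix.mul_assoc (Matrix.diagonal e), hee, Matrix.one_mul]
  · have hq : ∀ i, (Zᵀ * (sigmaY ⊗ₖ sigmaY) * Z) i i = 1 / 4 * ∑ j, w j * s j := fun i => by
      have : Zᵀ * (sigmaY ⊗ₖ sigmaY) * Z = halfHadamardᵀ *
          (Matrix.diagonal (fun j => w j * s j) * halfHadamard) := by
        have h3 : Matrix.diagonal (fun j => w j * s j) =
            Matrix.diagonal e * (Yᵀ * (sigmaY ⊗ₖ sigmaY) * Y) * Matrix.diagonal e := by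
          rw [hd, Matrix.diagonal_mul_diagonal, Matrix.diagonal_mul_diagonal]
          congr 1
          ext j
          rw [← he]
          ring
        rw [h3, hZ, Matrix.transpose_mul, Matrix.transpose_mul, Matrix.diagonal_transpose]
        simp only [Matrix.mul_assoc]
      rw [this, Matrix.mul_apply, Finset.mul_sum]
      refine Finset.sum_congr rfl fun j _ => ?_
      rw [Matrix.diagonal_mul, Matrix.transpose_apply]
      linear_combination (w j * s j) * halfHadamard_apply_sq j i
    have hn : ∀ i, 2 * ‖vecDet fun x => Z x i‖ = 1 / 4 * ‖∑ j, w j * s j‖ := fun i => by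
      have := congrArg norm ((sigmaY_quadratic_apply Z i).symm.trans (hq i))
      rw [norm_mul, norm_mul] at this
      simpa using this
    simp_rw [hn]
    rw [concurrence]
    have e2 : (woottersNumbers ρ).sum = ∑ j, s j := by rw [hw]; rfl
    rw [e2]
    simpa [← mul_assoc] using hsum

/-- For `X` with entries `a, b, c, d` the right side is `tr (X X̄) = |a|² + |d|² + 2 Re (b c̄) ≥
2|ad| - 2|bc|`. -/
theorem neg_two_mul_norm_det_le (a b c d : ℂ) :
    -(2 * ‖a * d - b * c‖) ≤ (a * star a + b * star c + (c * star b + d * star d)).re := by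
  have h1 : -(‖b‖ * ‖c‖) ≤ (b * star c).re := by
    have := Complex.abs_re_le_norm (b * star c)
    rw [norm_mul, norm_star] at this
    exact (abs_le.mp this).1
  have h2 : (c * star b).re = (b * star c).re := by
    simp; ring
  have h3 : ‖b‖ * ‖c‖ - ‖a‖ * ‖d‖ ≤ ‖a * d - b * c‖ := by
    rw [← norm_mul, ← norm_mul, norm_sub_rev]
    exact norm_sub_norm_le _ _
  have h4 : ∀ z : ℂ, (z * star z).re = ‖z‖ ^ 2 := fun z => by
    rw [Complex.star_def, Complex.mul_conj, Complex.normSq_eq_norm_sq, Complex.ofReal_re]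
  simp only [Complex.add_re, h2, h4]
  nlinarith [sq_nonneg (‖a‖ - ‖d‖)]

theorem neg_norm_vecDet_le_of_pure (φ ψ : Fin 2 × Fin 2 → ℂ) :
    -(2 * (‖vecDet φ‖ * ‖vecDet ψ‖)) ≤
      (star ψ ⬝ᵥ partialTranspose (Matrix.vecMulVec φ (star φ)) *ᵥ ψ).re := by
  -- These are the entries of `X = Φᴴ Ψ`, with `Φ, Ψ` the coefficient matrices; the expectation is
  -- `tr (X X̄)`.
  have h := neg_two_mul_norm_det_le
    (star (φ (0, 0)) * ψ (0, 0) + star (φ (1, 0)) * ψ (1, 0))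
    (star (φ (0, 0)) * ψ (0, 1) + star (φ (1, 0)) * ψ (1, 1))
    (star (φ (0, 1)) * ψ (0, 0) + star (φ (1, 1)) * ψ (1, 0))
    (star (φ (0, 1)) * ψ (0, 1) + star (φ (1, 1)) * ψ (1, 1))
  convert h using 1
  · rw [← norm_star (vecDet φ), ← norm_mul]
    congr 3
    simp only [vecDet, star_sub, star_mul']
    ring
  · congr 1
    simp only [dotProduct, Matrix.mulVec, Fintype.sum_prod_type, Fin.sum_univ_two,
      partialTranspose, Matrix.of_apply, Matrix.vecMulVec_apply, Pi.star_apply, star_add,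
      star_mul', star_star]
    ring

theorem neg_norm_vecDet_mul_concurrence_le {ρ : Op 2 2} (hρ : ρ.PosSemidef)
    (ψ : Fin 2 × Fin 2 → ℂ) :
    -(‖vecDet ψ‖ * concurrence ρ) ≤ (star ψ ⬝ᵥ partialTranspose ρ *ᵥ ψ).re := by
  obtain ⟨Z, hZ, hC⟩ := exists_decomposition_sum_norm_vecDet_le hρ
  have h1 : ρ = ∑ i, Matrix.vecMulVec (fun x => Z x i) (star fun x => Z x i) := by
    rw [hZ]
    ext x y
    simp [Matrix.sum_apply, Matrix.mul_apply, Matrix.vecMulVec_apply]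
  have h2 : star ψ ⬝ᵥ partialTranspose ρ *ᵥ ψ = ∑ i, star ψ ⬝ᵥ
      partialTranspose (Matrix.vecMulVec (fun x => Z x i) (star fun x => Z x i)) *ᵥ ψ := by
    conv_lhs => rw [h1]
    rw [partialTranspose_sum, Matrix.sum_mulVec, dotProduct_sum]
  rw [h2, Complex.re_sum]
  refine le_trans ?_ (Finset.sum_le_sum fun i _ =>
    neg_norm_vecDet_le_of_pure (fun x => Z x i) ψ)
  rw [Finset.sum_neg_distrib, neg_le_neg_iff]
  calc _ = ‖vecDet ψ‖ * ∑ i, 2 * ‖vecDet fun x => Z x i‖ := by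
        rw [Finset.mul_sum]
        exact Finset.sum_congr rfl fun i _ => by ring
    _ ≤ _ := mul_le_mul_of_nonneg_left hC (norm_nonneg _)

end Concurrence

/-! ### Jordan decomposition and the single negative eigenvalue -/

section Negativity

theorem negativity_eq {ρ : Op 2 2} (h : (partialTranspose ρ).IsHermitian) :
    negativity ρ = 2 * ∑ i, max 0 (-h.eigenvalues i) := by
  rw [negativity, eigenvalueMultiset, h.roots_charpoly_eq_eigenvalues, Multiset.map_map]
  congr 1

theorem negativity_nonneg (ρ : Op 2 2) : 0 ≤ negativity ρ :=
  mul_nonneg two_pos.le (Multiset.sum_nonneg fun x hx => by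
    obtain ⟨z, _, rfl⟩ := Multiset.mem_map.mp hx
    exact le_max_left _ _)

theorem hasJordanTraces_negativity {ρ : Op 2 2} (hρ : IsState ρ) :
    HasJordanTraces ρ ((1 + negativity ρ / 2 : ℝ) : ℂ) ((negativity ρ / 2 : ℝ) : ℂ) := by
  have h := isHermitian_partialTranspose hρ.posSemidef.isHermitian
  set U : Op 2 2 := h.eigenvectorUnitary.1
  have hUU : Uᴴ * U = 1 := Unitary.coe_star_mul_self h.eigenvectorUnitary
  have htr : ∀ f : Fin 2 × Fin 2 → ℂ, (U * Matrix.diagonal f * Uᴴ).trace = ∑ i, f i := fun f => by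
    rw [Matrix.trace_mul_cycle, hUU, one_mul, Matrix.trace_diagonal]
  have hpos : ∀ f : Fin 2 × Fin 2 → ℝ, (∀ i, 0 ≤ f i) →
      (U * Matrix.diagonal (fun i => (f i : ℂ)) * Uᴴ).PosSemidef := fun f hf =>
    (Matrix.PosSemidef.diagonal fun i => by
      simpa using hf i).mul_mul_conjTranspose_same U
  have hspec : partialTranspose ρ = U * Matrix.diagonal (fun i => (h.eigenvalues i : ℂ)) * Uᴴ :=
    h.spectral_theorem
  have hq : ((negativity ρ / 2 : ℝ) : ℂ) = ∑ i, ((max 0 (-h.eigenvalues i) : ℝ) : ℂ) := by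
    rw [negativity_eq h, mul_div_cancel_left₀ _ two_ne_zero, Complex.ofReal_sum]
  have hd : ∀ x : ℝ, x = max 0 x - max 0 (-x) := fun x => by
    rcases le_total 0 x with hx | hx
    · rw [max_eq_right hx, max_eq_left (by linarith), sub_zero]
    · rw [max_eq_left hx, max_eq_right (by linarith)]; ring
  have h1 : ∑ i, (h.eigenvalues i : ℂ) = 1 := by
    rw [← htr, ← hspec, trace_partialTranspose, hρ.trace_eq_one]
  refine ⟨_, _, hpos (fun i => max 0 (h.eigenvalues i)) fun i => le_max_left _ _,
    hpos (fun i => max 0 (-h.eigenvalues i)) fun i => le_max_left _ _, ?_, ?_, ?_⟩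
  · refine hspec.trans ?_
    rw [← sub_mul, ← mul_sub, Matrix.diagonal_sub]
    congr 3
    ext i
    rw [← Complex.ofReal_sub, ← hd]
  · rw [htr, Complex.ofReal_add, hq, Complex.ofReal_one, ← h1, ← Finset.sum_add_distrib]
    refine Finset.sum_congr rfl fun i _ => ?_
    rw [← Complex.ofReal_add]
    congr 1
    linarith [hd (h.eigenvalues i)]
  · rw [htr, hq]

/-- Every two-dimensional subspace contains a product vector: `det (φ + x ψ)` is quadratic in `x`
when `det ψ ≠ 0`, hence has a complex root. -/
theorem exists_vecDet_combination_eq_zero (φ ψ : Fin 2 × Fin 2 → ℂ) :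
    ∃ c d : ℂ, (c ≠ 0 ∨ d ≠ 0) ∧ vecDet (c • φ + d • ψ) = 0 := by
  by_cases h : vecDet ψ = 0
  · exact ⟨0, 1, Or.inr one_ne_zero, by simpa using h⟩
  · obtain ⟨r, hr⟩ := IsAlgClosed.exists_pow_nat_eq (discrim (vecDet ψ)
      (φ (0, 0) * ψ (1, 1) + ψ (0, 0) * φ (1, 1) - φ (0, 1) * ψ (1, 0) - ψ (0, 1) * φ (1, 0))
      (vecDet φ)) two_pos
    obtain ⟨x, hx⟩ := exists_quadratic_eq_zero h ⟨r, by rw [← hr, pow_two]⟩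
    refine ⟨1, x, Or.inl one_ne_zero, ?_⟩
    rw [← hx]
    simp only [vecDet, Pi.add_apply, Pi.smul_apply, smul_eq_mul]
    ring

/-- The partial transpose of a two-qubit state has at most one negative eigenvalue. -/
theorem eigenvalues_partialTranspose_unique_neg {ρ : Op 2 2} (hρ : ρ.PosSemidef)
    (h : (partialTranspose ρ).IsHermitian) {i j : Fin 2 × Fin 2} (hi : h.eigenvalues i < 0)
    (hj : h.eigenvalues j < 0) : i = j := by
  by_contra hij
  set v : Fin 2 × Fin 2 → Fin 2 × Fin 2 → ℂ := fun k => (h.eigenvectorBasis k).ofLp with hv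
  have hort : ∀ k l, star (v k) ⬝ᵥ v l = if k = l then 1 else 0 := fun k l => by
    rw [← orthonormal_iff_ite.mp h.eigenvectorBasis.orthonormal k l,
      EuclideanSpace.inner_eq_star_dotProduct, dotProduct_comm]
  have heig : ∀ k, partialTranspose ρ *ᵥ v k = (h.eigenvalues k : ℂ) • v k := fun k => by
    simpa using h.mulVec_eigenvectorBasis k
  obtain ⟨c, d, hcd, hdet⟩ := exists_vecDet_combination_eq_zero (v i) (v j)
  -- A product vector has nonnegative expectation, yet a nonzero combination of two negative
  -- eigenvectors has a negative one.
  have key := neg_norm_vecDet_mul_concurrence_le hρ (c • v i + d • v j)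
  have e : star (c • v i + d • v j) ⬝ᵥ partialTranspose ρ *ᵥ (c • v i + d • v j) =
      ((‖c‖ ^ 2 * h.eigenvalues i + ‖d‖ ^ 2 * h.eigenvalues j : ℝ) : ℂ) := by
    simp only [Matrix.mulVec_add, Matrix.mulVec_smul, heig, star_add, star_smul, add_dotProduct,
      dotProduct_add, smul_dotProduct, dotProduct_smul, hort, if_true, if_neg hij,
      if_neg (Ne.symm hij), smul_eq_mul]
    push_cast
    rw [← Complex.conj_mul', ← Complex.conj_mul']
    simp only [Complex.star_def]
    ring
  rw [e, hdet, norm_zero, zero_mul, neg_zero, Complex.ofReal_re] at key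
  rcases hcd with hc | hd
  · nlinarith [pow_pos (norm_pos_iff.mpr hc) 2, pow_nonneg (norm_nonneg d) 2,
      mul_pos_of_neg_of_neg (neg_neg_of_pos (pow_pos (norm_pos_iff.mpr hc) 2)) hi]
  · nlinarith [pow_pos (norm_pos_iff.mpr hd) 2, pow_nonneg (norm_nonneg c) 2,
      mul_pos_of_neg_of_neg (neg_neg_of_pos (pow_pos (norm_pos_iff.mpr hd) 2)) hj]

theorem exists_unit_vector_expectation_eq {ρ : Op 2 2} (hρ : ρ.PosSemidef)
    (hN : 0 < negativity ρ) : ∃ ψ : Fin 2 × Fin 2 → ℂ, star ψ ⬝ᵥ ψ = 1 ∧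
      (star ψ ⬝ᵥ partialTranspose ρ *ᵥ ψ).re = -(negativity ρ / 2) := by
  have h := isHermitian_partialTranspose hρ.isHermitian
  obtain ⟨i, hi⟩ : ∃ i, h.eigenvalues i < 0 := by
    by_contra! hc
    rw [negativity_eq h, Finset.sum_eq_zero fun i _ => max_eq_left (neg_nonpos.mpr (hc i))] at hN
    simp at hN
  refine ⟨(h.eigenvectorBasis i).ofLp, ?_, ?_⟩
  · have := orthonormal_iff_ite.mp h.eigenvectorBasis.orthonormal i i
    rwa [EuclideanSpace.inner_eq_star_dotProduct, dotProduct_comm, if_pos rfl] at this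
  · have h1 := h.eigenvalues_eq i
    rw [RCLike.re_eq_complex_re] at h1
    rw [← h1, negativity_eq h, Finset.sum_eq_single i, max_eq_right (by linarith)]
    · ring
    · intro j _ hj
      refine max_eq_left (neg_nonpos.mpr (not_lt.mp fun hj' => hj ?_))
      exact eigenvalues_partialTranspose_unique_neg hρ h hj' hi
    · simp

end Negativity

/-! ### The filtering protocol -/

section Protocol

theorem isLOCC_discard :
    ∃ Λ : Op 2 2 → Op 2 2, IsLOCC Λ ∧
      ∀ ρ, Λ ρ = ρ.trace • Matrix.single ((0 : Fin 2), (0 : Fin 2)) (0, 0) 1 := by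
  have hK : ∑ i : Fin 2, (Matrix.single (0 : Fin 2) i (1 : ℂ))ᴴ * Matrix.single 0 i 1 = 1 := by
    ext i j
    fin_cases i <;> fin_cases j <;> simp [Matrix.single, Matrix.mul_apply]
  refine ⟨_, IsLOCC.alice (fun _ => 2) (fun i => Matrix.single 0 i 1) hK _ fun _ =>
    IsLOCC.bob (fun _ => 2) (fun i => Matrix.single 0 i 1) hK _ fun _ => IsLOCC.done, fun ρ => ?_⟩
  ext ⟨x1, x2⟩ ⟨y1, y2⟩
  simp only [Matrix.sum_apply, one_kronecker_conj_apply, kronecker_one_conj_apply]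
  fin_cases x1 <;> fin_cases x2 <;> fin_cases y1 <;> fin_cases y2 <;>
    simp [Matrix.single, Matrix.trace, Fintype.sum_prod_type]

/-- Alice filters with `K`; if the filter fails, the state is replaced by `|00⟩`. -/
theorem isLOCC_filter {K L : Matrix (Fin 2) (Fin 2) ℂ} (hKL : Kᴴ * K + Lᴴ * L = 1) :
    ∃ Λ : Op 2 2 → Op 2 2, IsLOCC Λ ∧ ∀ ρ, Λ ρ =
      (K ⊗ₖ (1 : Matrix (Fin 2) (Fin 2) ℂ)) * ρ * (K ⊗ₖ (1 : Matrix (Fin 2) (Fin 2) ℂ))ᴴ +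
      ((L ⊗ₖ (1 : Matrix (Fin 2) (Fin 2) ℂ)) * ρ *
        (L ⊗ₖ (1 : Matrix (Fin 2) (Fin 2) ℂ))ᴴ).trace •
        Matrix.single ((0 : Fin 2), (0 : Fin 2)) (0, 0) 1 := by
  obtain ⟨Λ, hΛ, h⟩ := isLOCC_discard
  refine ⟨_, IsLOCC.alice (fun _ => 2) ![K, L] (by simpa using hKL) ![fun ρ => ρ, Λ]
    (Fin.forall_fin_two.mpr ⟨IsLOCC.done, hΛ⟩), fun ρ => ?_⟩
  rw [Fin.sum_univ_two, ← h]
  rfl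

theorem bellVector_expectation (σ : Op 2 2) : star bellVector ⬝ᵥ σ *ᵥ bellVector =
    1 / 2 * (σ (0, 0) (0, 0) + σ (0, 0) (1, 1) + σ (1, 1) (0, 0) + σ (1, 1) (1, 1)) := by
  rw [← sqrt_two_div_two_mul_self]
  simp only [dotProduct, Matrix.mulVec, Fintype.sum_prod_type, Fin.sum_univ_two, bellVector,
    Pi.star_apply, Complex.star_def, Complex.conj_ofReal, if_true, zero_ne_one, one_ne_zero,
    if_false, map_zero]
  ring

theorem half_le_maxFidelity {ρ : Op 2 2} (hρ : IsState ρ) : 1 / 2 ≤ maxFidelity ρ := by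
  obtain ⟨Λ, hΛ, h⟩ := isLOCC_discard
  have := le_maxFidelity (hasJordanTraces_negativity hρ) hΛ isMaximallyEntangled_bellVector
  rw [h, hρ.trace_eq_one, bellVector_expectation] at this
  simpa [Matrix.single] using this

/-- The filter that maps `ψ` to a multiple of the singlet. -/
def singletFilter (ψ : Fin 2 × Fin 2 → ℂ) : Matrix (Fin 2) (Fin 2) ℂ :=
  !![star (ψ (0, 1)), star (ψ (1, 1)); -star (ψ (0, 0)), -star (ψ (1, 0))]

/-- The Bell projector is `1/2 - S^Γ` with `S` the singlet projector, and the adjoint filter sends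
the singlet to `ψ / √2`. -/
theorem singletFilter_expectation (ρ : Op 2 2) (ψ : Fin 2 × Fin 2 → ℂ) :
    star bellVector ⬝ᵥ ((singletFilter ψ ⊗ₖ (1 : Matrix (Fin 2) (Fin 2) ℂ)) * ρ *
      (singletFilter ψ ⊗ₖ (1 : Matrix (Fin 2) (Fin 2) ℂ))ᴴ) *ᵥ bellVector =
    1 / 2 * ((singletFilter ψ ⊗ₖ (1 : Matrix (Fin 2) (Fin 2) ℂ)) * ρ *
      (singletFilter ψ ⊗ₖ (1 : Matrix (Fin 2) (Fin 2) ℂ))ᴴ).trace -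
    1 / 2 * (star ψ ⬝ᵥ partialTranspose ρ *ᵥ ψ) := by
  rw [bellVector_expectation]
  simp only [Matrix.trace, Matrix.diag_apply, kronecker_one_conj_apply, dotProduct, Matrix.mulVec,
    Fintype.sum_prod_type, Fin.sum_univ_two, partialTranspose, Matrix.of_apply, Pi.star_apply,
    singletFilter, Matrix.cons_val', Matrix.cons_val_zero, Matrix.cons_val_one,
    Matrix.cons_val_fin_one, star_star, star_neg]
  ring

theorem posSemidef_of_trace_of_det {M : Matrix (Fin 2) (Fin 2) ℂ} (hM : M.IsHermitian)
    (ht : 0 ≤ M.trace.re) (hd : 0 ≤ M.det.re) : M.PosSemidef := by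
  rw [hM.trace_eq_sum_eigenvalues, Fin.sum_univ_two] at ht
  rw [hM.det_eq_prod_eigenvalues, Fin.prod_univ_two] at hd
  have ht' : 0 ≤ hM.eigenvalues 0 + hM.eigenvalues 1 := by simpa using ht
  have hd' : 0 ≤ hM.eigenvalues 0 * hM.eigenvalues 1 := by simpa using hd
  rw [hM.posSemidef_iff_eigenvalues_nonneg, Pi.le_def, Fin.forall_fin_two]
  simp only [Pi.zero_apply]
  constructor
  · by_contra! h
    nlinarith
  · by_contra! h
    nlinarith

theorem sum_norm_sq_eq_one {ψ : Fin 2 × Fin 2 → ℂ} (hψ : star ψ ⬝ᵥ ψ = 1) :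
    ‖ψ (0, 0)‖ ^ 2 + ‖ψ (0, 1)‖ ^ 2 + ‖ψ (1, 0)‖ ^ 2 + ‖ψ (1, 1)‖ ^ 2 = 1 := by
  have h := congrArg Complex.re hψ
  simp only [dotProduct, Pi.star_apply, Complex.star_def, Complex.conj_mul',
    Fintype.sum_prod_type, Fin.sum_univ_two] at h
  norm_cast at h
  linarith

theorem two_mul_norm_vecDet_le_one {ψ : Fin 2 × Fin 2 → ℂ} (hψ : star ψ ⬝ᵥ ψ = 1) :
    2 * ‖vecDet ψ‖ ≤ 1 := by
  have h := norm_sub_le (ψ (0, 0) * ψ (1, 1)) (ψ (0, 1) * ψ (1, 0))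
  rw [norm_mul, norm_mul] at h
  have := sum_norm_sq_eq_one hψ
  have e : vecDet ψ = ψ (0, 0) * ψ (1, 1) - ψ (0, 1) * ψ (1, 0) := rfl
  rw [e]
  nlinarith [sq_nonneg (‖ψ (0, 0)‖ - ‖ψ (1, 1)‖), sq_nonneg (‖ψ (0, 1)‖ - ‖ψ (1, 0)‖)]

/-- The Gram matrix of the filter has trace `1` and determinant `|det ψ|²`, so its largest
eigenvalue is `(1 + √(1 - 4 |det ψ|²)) / 2 ≤ (1 + t) / 2`. -/
theorem exists_singletFilter_complement {ψ : Fin 2 × Fin 2 → ℂ} (hψ : star ψ ⬝ᵥ ψ = 1) {t : ℝ}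
    (ht : 0 ≤ t) (htd : 1 - (2 * ‖vecDet ψ‖) ^ 2 ≤ t ^ 2) :
    ∃ L : Matrix (Fin 2) (Fin 2) ℂ, (singletFilter ψ)ᴴ * singletFilter ψ + Lᴴ * L =
      (((1 + t) / 2 : ℝ) : ℂ) • 1 := by
  set G := (singletFilter ψ)ᴴ * singletFilter ψ with hG
  set r : ℝ := (1 + t) / 2 with hr
  have htr : G.trace = 1 := by
    rw [← hψ]
    simp [hG, singletFilter, Matrix.trace, Matrix.mul_apply, dotProduct, Fintype.sum_prod_type]
    ring
  have hdet : G.det = ((‖vecDet ψ‖ ^ 2 : ℝ) : ℂ) := by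
    have : (singletFilter ψ).det = star (vecDet ψ) := by
      rw [Matrix.det_fin_two]
      simp [singletFilter, vecDet]
      ring
    rw [hG, Matrix.det_mul, Matrix.det_conjTranspose, this, star_star, Complex.star_def,
      Complex.mul_conj, Complex.normSq_eq_norm_sq]
  have hM : ((r : ℂ) • (1 : Matrix (Fin 2) (Fin 2) ℂ) - G).PosSemidef := by
    apply posSemidef_of_trace_of_det
    · rw [Matrix.IsHermitian, Matrix.conjTranspose_sub, hG, Matrix.conjTranspose_mul,
        Matrix.conjTranspose_conjTranspose, Matrix.conjTranspose_smul]
      simp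
    · rw [Matrix.trace_sub, htr, Matrix.trace_smul, Matrix.trace_one]
      simp [hr]
      linarith
    · have h1 : ((r : ℂ) • (1 : Matrix (Fin 2) (Fin 2) ℂ) - G).det =
          ((r ^ 2 - r + ‖vecDet ψ‖ ^ 2 : ℝ) : ℂ) := by
        push_cast
        rw [Complex.ofReal_pow] at hdet
        rw [← hdet]
        have h2 : (r : ℂ) = r * G.trace := by rw [htr, mul_one]
        conv_rhs => rw [sub_eq_add_neg]; enter [1, 2]; rw [h2]
        simp [Matrix.det_fin_two, Matrix.trace]
        ring
      rw [h1, Complex.ofReal_re, hr]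
      nlinarith
  obtain ⟨L, hL⟩ := exists_eq_conjTranspose_mul_self hM
  exact ⟨L, by rw [← hL]; abel⟩

theorem le_maxFidelity_of_expectation {ρ : Op 2 2} (hρ : IsState ρ) {ψ : Fin 2 × Fin 2 → ℂ}
    (hψ : star ψ ⬝ᵥ ψ = 1) {t : ℝ} (ht : 0 ≤ t) (htd : 1 - (2 * ‖vecDet ψ‖) ^ 2 ≤ t ^ 2) :
    1 / 2 * (1 - 2 * (star ψ ⬝ᵥ partialTranspose ρ *ᵥ ψ).re / (1 + t)) ≤ maxFidelity ρ := by
  obtain ⟨L₀, hL₀⟩ := exists_singletFilter_complement hψ ht htd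
  set r : ℝ := (1 + t) / 2 with hr
  have hr0 : 0 < r := by positivity
  -- Rescaling by `x` makes the two Kraus operators complete; `x² = 2 / (1 + t)` is the gain in the
  -- final bound.
  set x : ℝ := (Real.sqrt r)⁻¹ with hx
  have hxr : x * x * r = 1 := by
    rw [hx, ← mul_inv, Real.mul_self_sqrt hr0.le, inv_mul_cancel₀ hr0.ne']
  have hxr' : (x : ℂ) * x * r = 1 := by exact_mod_cast hxr
  have hsc : ∀ A : Matrix (Fin 2) (Fin 2) ℂ,
      ((x : ℂ) • A)ᴴ * ((x : ℂ) • A) = ((x : ℂ) * x) • (Aᴴ * A) := fun A => by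
    rw [Matrix.conjTranspose_smul, Matrix.smul_mul, Matrix.mul_smul, smul_smul, Complex.star_def,
      Complex.conj_ofReal]
  have hf : (x : ℂ) • singletFilter ψ = singletFilter ((x : ℂ) • ψ) := by
    ext i j
    fin_cases i <;> fin_cases j <;> simp [singletFilter]
  have hKL : (singletFilter ((x : ℂ) • ψ))ᴴ * singletFilter ((x : ℂ) • ψ) +
      ((x : ℂ) • L₀)ᴴ * ((x : ℂ) • L₀) = 1 := by
    rw [← hf, hsc, hsc, ← smul_add, hL₀, smul_smul, hxr', one_smul]
  obtain ⟨Λ, hΛ, h⟩ := isLOCC_filter hKL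
  have hF := le_maxFidelity (hasJordanTraces_negativity hρ) hΛ isMaximallyEntangled_bellVector
  set M := (singletFilter ((x : ℂ) • ψ) ⊗ₖ (1 : Matrix (Fin 2) (Fin 2) ℂ)) * ρ *
    (singletFilter ((x : ℂ) • ψ) ⊗ₖ (1 : Matrix (Fin 2) (Fin 2) ℂ))ᴴ with hM
  set M' := (((x : ℂ) • L₀) ⊗ₖ (1 : Matrix (Fin 2) (Fin 2) ℂ)) * ρ *
    (((x : ℂ) • L₀) ⊗ₖ (1 : Matrix (Fin 2) (Fin 2) ℂ))ᴴ with hM'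
  have htr : M.trace + M'.trace = 1 := by
    rw [hM, hM', Matrix.trace_mul_comm, ← Matrix.mul_assoc, Matrix.trace_mul_comm _ (_ᴴ),
      ← Matrix.mul_assoc, ← Matrix.trace_add, ← Matrix.add_mul, Matrix.conjTranspose_kronecker,
      Matrix.conjTranspose_kronecker, ← Matrix.mul_kronecker_mul, ← Matrix.mul_kronecker_mul,
      ← Matrix.add_kronecker, Matrix.conjTranspose_one, one_mul, hKL, Matrix.one_kronecker_one,
      one_mul, hρ.trace_eq_one]
  have hscal : star ((x : ℂ) • ψ) ⬝ᵥ partialTranspose ρ *ᵥ ((x : ℂ) • ψ) =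
      ((x * x : ℝ) : ℂ) * (star ψ ⬝ᵥ partialTranspose ρ *ᵥ ψ) := by
    rw [star_smul, Matrix.mulVec_smul, smul_dotProduct, dotProduct_smul, Complex.star_def,
      Complex.conj_ofReal]
    push_cast
    simp only [smul_eq_mul]
    ring
  -- `|00⟩` has Bell overlap `1/2`, so both branches contribute half their probability, which totals
  -- `1/2`.
  have hval : star bellVector ⬝ᵥ Λ ρ *ᵥ bellVector =
      1 / 2 - 1 / 2 * (((x * x : ℝ) : ℂ) * (star ψ ⬝ᵥ partialTranspose ρ *ᵥ ψ)) := by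
    rw [h, Matrix.add_mulVec, dotProduct_add, singletFilter_expectation, hscal,
      bellVector_expectation]
    simp only [Matrix.smul_apply, Matrix.single, Matrix.of_apply, smul_eq_mul]
    simp only [and_self, if_true, Prod.mk.injEq, zero_ne_one, if_false, and_false,
      false_and]
    linear_combination 1 / 2 * htr
  rw [hval, show (1 / 2 : ℂ) = ((1 / 2 : ℝ) : ℂ) by push_cast; rfl, Complex.sub_re,
    Complex.re_ofReal_mul, Complex.re_ofReal_mul, Complex.ofReal_re] at hF
  refine le_trans (le_of_eq ?_) hF
  have : x * x = 2 / (1 + t) := by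
    rw [eq_div_iff (by positivity)]
    rw [hr] at hxr
    linarith
  rw [this]
  ring

end Protocol

end TwoQubit

end

/-! ### Assembly of the bounds -/

theorem mainTheorem4 (ρ : TwoQubit.Op 2 2) (hρ : TwoQubit.IsState ρ) :
    TwoQubit.negativity ρ ≤ TwoQubit.concurrence ρ ∧
    1 / 2 * (1 + TwoQubit.negativity ρ /
        (1 + Real.sqrt (1 - (TwoQubit.negativity ρ / TwoQubit.concurrence ρ) ^ 2)))
      ≤ TwoQubit.maxFidelity ρ ∧
    TwoQubit.maxFidelity ρ ≤ 1 / 2 * (1 + TwoQubit.negativity ρ) := by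
  have hC0 : 0 ≤ TwoQubit.concurrence ρ := le_max_left _ _
  have hupper : TwoQubit.maxFidelity ρ ≤ 1 / 2 * (1 + TwoQubit.negativity ρ) := by
    refine (TwoQubit.maxFidelity_le (TwoQubit.hasJordanTraces_negativity hρ)).trans (le_of_eq ?_)
    rw [Complex.ofReal_re, Complex.ofReal_re]
    ring
  rcases (TwoQubit.negativity_nonneg ρ).eq_or_lt with hN | hN
  -- With `N = 0` the lower bound is `1/2`, whatever the quotient `N / C` is; this covers `C = 0`.
  · refine ⟨hN ▸ hC0, ?_, hupper⟩
    rw [← hN, zero_div, add_zero, mul_one]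
    exact TwoQubit.half_le_maxFidelity hρ
  · obtain ⟨ψ, hψ, hv⟩ := TwoQubit.exists_unit_vector_expectation_eq hρ.posSemidef hN
    have hkey := TwoQubit.neg_norm_vecDet_mul_concurrence_le hρ.posSemidef ψ
    rw [hv] at hkey
    have hle : TwoQubit.negativity ρ ≤ 2 * ‖TwoQubit.vecDet ψ‖ * TwoQubit.concurrence ρ := by
      linarith
    have hC : 0 < TwoQubit.concurrence ρ := by
      refine hC0.lt_of_ne fun h => ?_
      rw [← h, mul_zero] at hle
      linarith
    have hd := TwoQubit.two_mul_norm_vecDet_le_one hψ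
    refine ⟨hle.trans (mul_le_of_le_one_left hC0 hd), ?_, hupper⟩
    have hq : (TwoQubit.negativity ρ / TwoQubit.concurrence ρ) ^ 2 ≤
        (2 * ‖TwoQubit.vecDet ψ‖) ^ 2 :=
      pow_le_pow_left₀ (by positivity) ((div_le_iff₀ hC).mpr hle) 2
    have := TwoQubit.le_maxFidelity_of_expectation hρ hψ (Real.sqrt_nonneg
      (1 - (TwoQubit.negativity ρ / TwoQubit.concurrence ρ) ^ 2))
      (by rw [Real.sq_sqrt']; exact le_max_of_le_left (by linarith))
    rw [hv] at this
    convert this using 3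
    ring
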